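/- Fix $\sigma^2>D_1>D_2>0$ and let $X_1,X_2,\dots$ be i.i.d. $\mathcal N(0,\sigma^2)$. An $(n,M_1,M_2)$-code consists of (measurable) encoders $f_i:\mathbb R^n\to\{1,\dots,M_i\}$, $i=1,2$, and decoders $\phi_1:\{1,\dots,M_1\}\to\mathbb R^n$ and $\phi_2:\{1,\dots,M_1\}\times\{1,\dots,M_2\}\to\mathbb R^n$. With $Y^n=\phi_1(f_1(X^n))$ and $Z^n=\phi_2(f_1(X^n),f_2(X^n))$, its joint excess-distortion probability is $$\epsilon_n(D_1,D_2)=\Pr\Big(\tfrac1n\sum_{i=1}^n(X_i-Y_i)^2>D_1\ \text{ or }\ \tfrac1n\sum_{i=1}^n(X_i-Z_i)^2>D_2\Big).$$ Let $\theta_1,\theta_2>0$ be real numbers and let $(\rho_n)_{n\ge1}$ be any real sequence with $\rho_n\to0$ and $\sqrt n\,\rho_n\to\infty$. A number $\nu\in\mathbb R$ is called an $(R_1^*,R_2^*)$-achievable moderate deviations constant if there is a sequence of $(n,M_1,M_2)$-codes (where $M_1,M_2$ may depend on $n$) such that $$\limsup_{n\to\infty}\frac{\log M_1-nR_1^*}{n\rho_n}\le\theta_1,\qquad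 \limsup_{n\to\infty}\frac{\log(M_1M_2)-nR_2^*}{n\rho_n}\le\theta_2,\qquad \liminf_{n\to\infty}-\frac{\log\epsilon_n(D_1,D_2)}{n\rho_n^2}\ge\nu,$$ and $\nu^*(R_1^*,R_2^*|D_1,D_2)$ denotes the supremum of all such $\nu$. Then (with natural logarithms): Case (i): if $\frac12\log\frac{\sigma^2}{D_1}<R_1^*<\frac12\log\frac{\sigma^2}{D_2}$ and $R_2^*=\frac12\log\frac{\sigma^2}{D_2}$, then $\nu^*(R_1^*,R_2^*|D_1,D_2)=\theta_2^2$. Case (ii): if $R_1^*=\frac12\log\frac{\sigma^2}{D_1}$ and $R_2^*>\frac12\log\frac{\sigma^2}{D_2}$, then $\nu^*(R_1^*,R_2^*|D_1,D_2)=\theta_1^2$. Case (iii): if $R_1^*=\frac12\log\frac{\sigma^2}{D_1}$ and $R_2^*=\frac12\log\frac{\sigma^2}{D_2}$, then $\nu^*(R_1^*,R_2^*|D_1,D_2)=\min\{\theta_1^2,\theta_2^2\}$. -/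

import Mathlib

open Filter Topology MeasureTheory ProbabilityTheory

open scoped ENNReal

noncomputable section

namespace SuccRef

/-- An `(n, M₁, M₂)`-code for successive refinement source coding with source alphabet `X` and
reproduction alphabets `Y`, `Z`. The encoders are measurable, so that the excess-distortion
event has a probability; the decoders have finite domains. -/
structure Code (X Y Z : Type*) [MeasurableSpace X] (n M₁ M₂ : ℕ) where
  /-- first encoder -/
  f₁ : (Fin n → X) → Fin M₁
  /-- second encoder -/
  f₂ : (Fin n → X) → Fin M₂
  measurable_f₁ : Measurable f₁
  measurable_f₂ : Measurable f₂
  /-- first decoder, which sees only the first message -/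
  φ₁ : Fin M₁ → (Fin n → Y)
  /-- second decoder, which sees both messages -/
  φ₂ : Fin M₁ × Fin M₂ → (Fin n → Z)

/-- The per-letter average distortion `(1/n) ∑ d(xᵢ, yᵢ)` between two blocks of length `n`. -/
def blockDistortion {X Y : Type*} (d : X → Y → ℝ) {n : ℕ} (x : Fin n → X) (y : Fin n → Y) : ℝ :=
  (1 / (n : ℝ)) * ∑ i, d (x i) (y i)

section General

variable {X Y Z : Type*} [MeasurableSpace X]

/-- The joint excess-distortion probability of a code, for the block `Xⁿ` of i.i.d. letters
with law `P`: the probability that at least one of the two reconstructions exceeds its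
distortion level. -/
def excessProb (P : Measure X) (d₁ : X → Y → ℝ) (d₂ : X → Z → ℝ) (D₁ D₂ : ℝ)
    {n M₁ M₂ : ℕ} (c : Code X Y Z n M₁ M₂) : ℝ≥0∞ :=
  (Measure.pi fun _ : Fin n => P)
    {x | D₁ < blockDistortion d₁ x (c.φ₁ (c.f₁ x)) ∨
      D₂ < blockDistortion d₂ x (c.φ₂ (c.f₁ x, c.f₂ x))}

/-- `ν` is an `(R₁, R₂)`-achievable moderate deviations constant for the speed `ρ` and the
backoff constants `θ₁`, `θ₂`. The second rate is the sum rate. Upper and lower limits are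
taken in the extended reals, and `-log 0 = ∞`. -/
def IsAchievableMD (P : Measure X) (d₁ : X → Y → ℝ) (d₂ : X → Z → ℝ) (D₁ D₂ : ℝ)
    (ρ : ℕ → ℝ) (θ₁ θ₂ R₁ R₂ ν : ℝ) : Prop :=
  ∃ (M₁ M₂ : ℕ → ℕ) (c : ∀ n, Code X Y Z n (M₁ n) (M₂ n)),
    limsup (fun n : ℕ =>
      (((1 / (n * ρ n)) * (Real.log (M₁ n) - n * R₁) : ℝ) : EReal)) atTop ≤ (θ₁ : EReal) ∧
    limsup (fun n : ℕ =>
      (((1 / (n * ρ n)) * (Real.log ((M₁ n : ℝ) * (M₂ n : ℝ)) - n * R₂) : ℝ) : EReal)) atTop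
        ≤ (θ₂ : EReal) ∧
    (ν : EReal) ≤ liminf (fun n : ℕ =>
      -ENNReal.log (excessProb P d₁ d₂ D₁ D₂ (c n)) / ((n * (ρ n) ^ 2 : ℝ) : EReal)) atTop

/-- The moderate deviations constant `ν*(R₁, R₂ | D₁, D₂)`: the supremum, in the extended reals,
of all achievable moderate deviations constants. -/
def mdConstant (P : Measure X) (d₁ : X → Y → ℝ) (d₂ : X → Z → ℝ) (D₁ D₂ : ℝ)
    (ρ : ℕ → ℝ) (θ₁ θ₂ R₁ R₂ : ℝ) : EReal :=
  ⨆ (ν : ℝ) (_ : IsAchievableMD P d₁ d₂ D₁ D₂ ρ θ₁ θ₂ R₁ R₂ ν), (ν : EReal)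

end General

/-- The quadratic distortion measure on `ℝ`. -/
def quadDist (x y : ℝ) : ℝ := (x - y) ^ 2

/-- The moderate deviations constant of the Gaussian memoryless source `N(0, σ²)` with quadratic
distortion measures at both decoders. -/
def gaussianMDConstant (σ D₁ D₂ : ℝ) (ρ : ℕ → ℝ) (θ₁ θ₂ R₁ R₂ : ℝ) : EReal :=
  mdConstant (gaussianReal 0 ⟨σ ^ 2, sq_nonneg σ⟩) quadDist quadDist D₁ D₂ ρ θ₁ θ₂ R₁ R₂

end SuccRef

end

namespace SuccRef

/-! Everything reduces to the upper tail of the power of a Gaussian vector: with `v = σ ^ 2`, the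
event `|X|² > n v exp (2 u)` has probability `exp (-n u²)`, to leading order in the exponent, for `u
= θ ρ n`. The relative entropy behind it is `n / 2 * (exp (2 u) - 1 - 2 u)`, about `n u²`.

Achievability (`exists_code`): the ball of power `v exp (2 u)` is covered, up to probability `exp
(-n)`, by a random codebook of rate about `1/2 log (v / D₁) + u`. The residual then has power at
most `D₁` and is covered at rate `1/2 log (D₁ / D₂)`. The backoff `u` is thus paid once and appears
equally in the first rate and in the sum rate; this is successive refinability. An error is
essentially a power above the ball.

Converse (`gaussPi_sqDist_gt_le_uncovered`): `M` balls of squared radius `n D` have at most the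
volume of one centred ball of squared radius `n D M ^ (2 / n)`, and the centred ball is the
likeliest set of its volume. So rate `1/2 log (v / D) + a` leaves at least the mass of power above
`v exp (2 a)` uncovered. It applies to `M₁` words at `D₁` and to `M₁ M₂` words at `D₂`.

All rate overheads are `O(√n)`, negligible against `n ρ n` because `√n ρ n → ∞`. A layer with
strictly spare rate imposes no limit; a tight one limits the exponent to the square of its backoff.
-/

/-- The squared Euclidean distance. -/
def sqDist {n : ℕ} (x y : Fin n → ℝ) : ℝ := ∑ i, (x i - y i) ^ 2

/-- The Gaussian law on `ℝⁿ` with mean `m` and covariance matrix `v • 1`. -/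
noncomputable def gaussPi {n : ℕ} (m : Fin n → ℝ) (v : ℝ) : Measure (Fin n → ℝ) :=
  Measure.pi fun i => gaussianReal (m i) v.toNNReal

instance {n : ℕ} (m : Fin n → ℝ) (v : ℝ) : IsProbabilityMeasure (gaussPi m v) := by
  unfold gaussPi; infer_instance

@[fun_prop]
lemma measurable_sqDist {n : ℕ} {α : Type*} [MeasurableSpace α] {f g : α → Fin n → ℝ}
    (hf : Measurable f) (hg : Measurable g) : Measurable fun a => sqDist (f a) (g a) := by
  unfold sqDist; fun_prop

/-! ### Gaussian densities and change of measure -/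

lemma pi_gaussianReal_eq_withDensity {ι : Type*} [Fintype ι] (m : ι → ℝ) {v : NNReal}
    (hv : v ≠ 0) :
    Measure.pi (fun i => gaussianReal (m i) v) =
      volume.withDensity fun x => ENNReal.ofReal (∏ i, gaussianPDFReal (m i) v (x i)) := by
  refine Measure.pi_eq fun s hs => ?_
  have hint : ∀ i, Integrable (gaussianPDFReal (m i) v) (volume.restrict (s i)) :=
    fun i => (integrable_gaussianPDFReal _ _).restrict
  rw [withDensity_apply _ (MeasurableSet.univ_pi hs), volume_pi, Measure.restrict_pi_pi,
    ← ofReal_integral_eq_lintegral_ofReal (Integrable.fintype_prod_dep hint)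
      (ae_of_all _ fun x => Finset.prod_nonneg fun i _ => gaussianPDFReal_nonneg _ _ _),
    integral_fintype_prod_eq_prod,
    ENNReal.ofReal_prod_of_nonneg fun i _ => integral_nonneg fun x => gaussianPDFReal_nonneg _ _ _]
  exact Finset.prod_congr rfl fun i _ => (gaussianReal_apply_eq_integral _ hv _).symm

/-- Writing the normalisation as an exponential too turns likelihood ratios into differences of
exponents. -/
lemma prod_gaussianPDFReal {n : ℕ} (m x : Fin n → ℝ) {v : ℝ} (hv : 0 < v) :
    ∏ i, gaussianPDFReal (m i) v.toNNReal (x i) =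
      Real.exp (-(n / 2) * Real.log (2 * Real.pi * v) - sqDist x m / (2 * v)) := by
  have h1 : (√(2 * Real.pi * v))⁻¹ = Real.exp (-(1 / 2) * Real.log (2 * Real.pi * v)) := by
    rw [Real.sqrt_eq_rpow, Real.rpow_def_of_pos (by positivity), ← Real.exp_neg]
    ring_nf
  simp only [gaussianPDFReal, Real.coe_toNNReal _ hv.le, h1, ← Real.exp_add, ← Real.exp_sum]
  congr 1
  rw [Finset.sum_add_distrib, Finset.sum_const, ← Finset.sum_div, sqDist]
  simp only [Finset.card_univ, Fintype.card_fin, nsmul_eq_mul, Finset.sum_neg_distrib]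
  ring

lemma gaussPi_eq_withDensity {n : ℕ} (m : Fin n → ℝ) {v : ℝ} (hv : 0 < v) :
    gaussPi m v = volume.withDensity fun x => ENNReal.ofReal
      (Real.exp (-(n / 2) * Real.log (2 * Real.pi * v) - sqDist x m / (2 * v))) := by
  rw [gaussPi, pi_gaussianReal_eq_withDensity m (by simpa using hv)]
  simp_rw [prod_gaussianPDFReal m _ hv]

/-- Change of measure between two Gaussian laws on a set where their log-likelihood ratio is
bounded. -/
lemma gaussPi_le_exp_mul {n : ℕ} (m m' : Fin n → ℝ) {v w : ℝ} (hv : 0 < v) (hw : 0 < w)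
    {A : Set (Fin n → ℝ)} (hA : MeasurableSet A) {L : ℝ}
    (h : ∀ x ∈ A, -(n / 2) * Real.log (v / w) - sqDist x m / (2 * v)
      + sqDist x m' / (2 * w) ≤ L) :
    gaussPi m v A ≤ ENNReal.ofReal (Real.exp L) * gaussPi m' w A := by
  rw [gaussPi_eq_withDensity m hv, gaussPi_eq_withDensity m' hw, withDensity_apply _ hA,
    withDensity_apply _ hA, ← lintegral_const_mul _ (by fun_prop)]
  refine setLIntegral_mono' hA fun x hx => ?_
  rw [← ENNReal.ofReal_mul (Real.exp_pos _).le, ← Real.exp_add]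
  refine ENNReal.ofReal_le_ofReal (Real.exp_le_exp.2 ?_)
  have := h x hx
  have hpi := Real.pi_pos
  rw [Real.log_div hv.ne' hw.ne'] at this
  rw [Real.log_mul (by positivity) hv.ne', Real.log_mul (by positivity) hw.ne']
  linarith

/-! ### Gaussian moments and concentration of the squared distance -/

/-- The moments are the derivatives at `0` of the moment generating function `exp (v t² / 2)`; each
derivative is a polynomial times this exponential. -/
lemma integral_pow_gaussianReal_zero (v : NNReal) :
    ∫ x, x ^ 3 ∂(gaussianReal 0 v) = 0 ∧ ∫ x, x ^ 4 ∂(gaussianReal 0 v) = 3 * v ^ 2 ∧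
      ∫ x, x ^ 2 ∂(gaussianReal 0 v) = v := by
  have h0 : (0 : ℝ) ∈ interior (integrableExpSet id (gaussianReal 0 v)) := by
    simp [integrableExpSet_id_gaussianReal]
  have key := fun k => iteratedDeriv_mgf_zero h0 k
  have hm : mgf id (gaussianReal 0 v) = fun t => Real.exp (v * t ^ 2 / 2) := by
    rw [mgf_id_gaussianReal]; simp
  have hE : ∀ t : ℝ, HasDerivAt (fun t : ℝ => Real.exp (v * t ^ 2 / 2))
      (Real.exp (v * t ^ 2 / 2) * (v * t)) t := fun t => by
    have : HasDerivAt (fun t : ℝ => v * t ^ 2 / 2) (v * t) t := by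
      have := (((hasDerivAt_id t).pow 2).const_mul (v : ℝ)).div_const 2
      refine this.congr_deriv ?_
      simp; ring
    exact this.exp
  have hd : ∀ (p p' : ℝ → ℝ), (∀ t, HasDerivAt p (p' t) t) →
      deriv (fun t : ℝ => p t * Real.exp (v * t ^ 2 / 2)) =
        fun t => (p' t + p t * (v * t)) * Real.exp (v * t ^ 2 / 2) := fun p p' hp => by
    funext t
    exact ((hp t).mul (hE t)).deriv.trans (by ring)
  have e1 : deriv (fun t : ℝ => Real.exp (v * t ^ 2 / 2)) =
      fun t : ℝ => (v * t) * Real.exp (v * t ^ 2 / 2) := by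
    funext t; rw [(hE t).deriv]; ring
  have e2 : deriv (fun t : ℝ => (v * t) * Real.exp (v * t ^ 2 / 2)) =
      fun t : ℝ => (v + v ^ 2 * t ^ 2) * Real.exp (v * t ^ 2 / 2) := by
    rw [hd _ (fun _ => v) fun t => by simpa using (hasDerivAt_id t).const_mul (v : ℝ)]
    funext t; ring
  have e3 : deriv (fun t : ℝ => (v + v ^ 2 * t ^ 2) * Real.exp (v * t ^ 2 / 2)) =
      fun t : ℝ => (3 * v ^ 2 * t + v ^ 3 * t ^ 3) * Real.exp (v * t ^ 2 / 2) := by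
    rw [hd _ (fun t => v ^ 2 * (2 * t)) fun t => by
      simpa using (((hasDerivAt_id t).pow 2).const_mul ((v : ℝ) ^ 2)).const_add (v : ℝ)]
    funext t; ring
  have e4 : deriv (fun t : ℝ => (3 * v ^ 2 * t + v ^ 3 * t ^ 3) * Real.exp (v * t ^ 2 / 2)) =
      fun t : ℝ => (3 * v ^ 2 + v ^ 3 * (3 * t ^ 2) + (3 * v ^ 2 * t + v ^ 3 * t ^ 3) * (v * t))
        * Real.exp (v * t ^ 2 / 2) := by
    rw [hd (fun t => 3 * v ^ 2 * t + v ^ 3 * t ^ 3) (fun t => 3 * v ^ 2 + v ^ 3 * (3 * t ^ 2)) fun t =>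
      (((hasDerivAt_id t).const_mul (3 * (v : ℝ) ^ 2)).add
        (((hasDerivAt_id t).pow 3).const_mul ((v : ℝ) ^ 3))).congr_deriv (by simp)]
  have k2 := key 2
  have k3 := key 3
  have k4 := key 4
  rw [hm] at k2 k3 k4
  simp only [iteratedDeriv_succ, iteratedDeriv_zero, e1, e2, e3, e4] at k2 k3 k4
  simp only [Pi.pow_apply, id] at k2 k3 k4
  refine ⟨?_, ?_, ?_⟩
  · simpa using k3.symm
  · simpa using k4.symm
  · simpa using k2.symm

lemma integrable_pow_gaussianReal (m : ℝ) (v : NNReal) (k : ℕ) :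
    Integrable (fun x : ℝ => x ^ k) (gaussianReal m v) := by
  by_cases hk : k = 0
  · subst hk; simp
  have := (memLp_id_gaussianReal (μ := m) (v := v) (k : NNReal)).integrable_norm_pow (by exact hk)
  refine this.mono' (by fun_prop) (ae_of_all _ fun x => ?_)
  simp

/-- Centring the variable and expanding in its first four moments gives the data for Chebyshev's
inequality. -/
lemma gaussianReal_sq_sub (m y : ℝ) (v : NNReal) :
    MemLp (fun x : ℝ => (x - y) ^ 2) 2 (gaussianReal m v) ∧
    ∫ x, (x - y) ^ 2 ∂(gaussianReal m v) = v + (m - y) ^ 2 ∧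
    Var[fun x : ℝ => (x - y) ^ 2; gaussianReal m v] = 2 * v ^ 2 + 4 * v * (m - y) ^ 2 := by
  set b := m - y with hb
  have hmap : gaussianReal m v = (gaussianReal 0 v).map (fun x => x + m) := by
    rw [gaussianReal_map_add_const]; simp
  obtain ⟨i3, i4, i2⟩ := integral_pow_gaussianReal_zero v
  have i1 : ∫ x, x ^ 1 ∂(gaussianReal 0 v) = 0 := by
    simp
  have q1 := integrable_pow_gaussianReal 0 v 1
  have q2 := integrable_pow_gaussianReal 0 v 2
  have q3 := integrable_pow_gaussianReal 0 v 3
  have q4 := integrable_pow_gaussianReal 0 v 4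
  have hmem : MemLp (fun x : ℝ => (x - y) ^ 2) 2 (gaussianReal m v) := by
    rw [memLp_two_iff_integrable_sq (by fun_prop), hmap,
      integrable_map_measure (by fun_prop) (by fun_prop)]
    have : ((fun x : ℝ => ((x - y) ^ 2) ^ 2) ∘ fun x => x + m) = fun x =>
        x ^ 4 + 4 * b * x ^ 3 + 6 * b ^ 2 * x ^ 2 + 4 * b ^ 3 * x ^ 1 + b ^ 4 := by
      funext x; simp only [Function.comp, hb]; ring
    rw [this]
    fun_prop
  have hmean : ∫ x, (x - y) ^ 2 ∂(gaussianReal m v) = v + b ^ 2 := by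
    rw [hmap, integral_map (by fun_prop) (by fun_prop)]
    have : ∀ x : ℝ, (x + m - y) ^ 2 = x ^ 2 + (2 * b * x ^ 1 + b ^ 2) := fun x => by
      rw [hb]; ring
    simp_rw [this]
    rw [integral_add (by fun_prop) (by fun_prop), integral_add (by fun_prop) (by fun_prop),
      integral_const_mul, i1, i2]
    simp
  refine ⟨hmem, hmean, ?_⟩
  rw [variance_eq_integral (by fun_prop), hmean, hmap, integral_map (by fun_prop) (by fun_prop)]
  have : ∀ x : ℝ, ((x + m - y) ^ 2 - (v + b ^ 2)) ^ 2 =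
      x ^ 4 + (4 * b * x ^ 3 + ((4 * b ^ 2 - 2 * v) * x ^ 2 + (-4 * b * v * x ^ 1 + v ^ 2))) :=
    fun x => by rw [hb]; ring
  simp_rw [this]
  rw [integral_add (by fun_prop) (by fun_prop), integral_add (by fun_prop) (by fun_prop),
    integral_add (by fun_prop) (by fun_prop), integral_add (by fun_prop) (by fun_prop),
    integral_const_mul, integral_const_mul, integral_const_mul, i1, i2, i3, i4]
  simp
  ring

/-- Chebyshev's inequality for the squared distance of a Gaussian vector to a fixed point. -/
lemma half_le_gaussPi_abs_sqDist_sub_lt {n : ℕ} (m y : Fin n → ℝ) {v : ℝ} (hv : 0 < v) {t : ℝ}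
    (ht : 0 < t) (hvar : 2 * (2 * n * v ^ 2 + 4 * v * sqDist m y) ≤ t ^ 2) :
    ENNReal.ofReal (1 / 2) ≤ gaussPi m v {x | |sqDist x y - (n * v + sqDist m y)| < t} := by
  have hG := fun i => gaussianReal_sq_sub (m i) (y i) v.toNNReal
  simp only [Real.coe_toNNReal _ hv.le] at hG
  have hfun : (fun x => sqDist x y) = ∑ i, fun x : Fin n → ℝ => (x i - y i) ^ 2 := by
    funext x; simp [sqDist]
  have hmem : ∀ i, MemLp (fun x : Fin n → ℝ => (x i - y i) ^ 2) 2 (gaussPi m v) := fun i =>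
    (hG i).1.comp_measurePreserving (measurePreserving_eval _ i)
  have hS : MemLp (fun x => sqDist x y) 2 (gaussPi m v) := by
    rw [hfun]; exact memLp_finsetSum' _ fun i _ => hmem i
  have hmean : ∫ x, sqDist x y ∂(gaussPi m v) = n * v + sqDist m y := by
    unfold sqDist
    rw [integral_finsetSum _ fun i _ => (hmem i).integrable (by norm_num)]
    have : ∀ i, ∫ x, (x i - y i) ^ 2 ∂(gaussPi m v) = v + (m i - y i) ^ 2 := fun i => by
      rw [← (hG i).2.1]
      exact integral_comp_eval (X := fun _ => ℝ) (i := i)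
        (μ := fun i => gaussianReal (m i) v.toNNReal)
        (f := fun z : ℝ => (z - y i) ^ 2) (by fun_prop)
    simp [this, Finset.sum_add_distrib]
  have hV : Var[fun x => sqDist x y; gaussPi m v] = 2 * n * v ^ 2 + 4 * v * sqDist m y := by
    rw [hfun, gaussPi, variance_sum_pi (X := fun i (z : ℝ) => (z - y i) ^ 2) fun i => (hG i).1]
    simp [(hG _).2.2, Finset.sum_add_distrib, sqDist, Finset.mul_sum]
    ring
  have hcheb := meas_ge_le_variance_div_sq hS ht
  rw [hmean, hV] at hcheb
  have hms : MeasurableSet {x : Fin n → ℝ | t ≤ |sqDist x y - (n * v + sqDist m y)|} :=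
    measurableSet_le measurable_const (by fun_prop)
  have hc : {x : Fin n → ℝ | |sqDist x y - (n * v + sqDist m y)| < t} =
      {x : Fin n → ℝ | t ≤ |sqDist x y - (n * v + sqDist m y)|}ᶜ := by
    ext; simp
  rw [hc, prob_compl_eq_one_sub hms]
  have : ENNReal.ofReal (1 / 2) = 1 - ENNReal.ofReal (1 / 2) := by
    rw [← ENNReal.ofReal_one, ← ENNReal.ofReal_sub _ (by norm_num)]; norm_num
  rw [this]
  refine tsub_le_tsub_left (hcheb.trans (ENNReal.ofReal_le_ofReal ?_)) _
  rw [div_le_iff₀ (by positivity)]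
  linarith

/-! ### Tails of the chi-square law -/

lemma sqDist_nonneg {n : ℕ} (x y : Fin n → ℝ) : 0 ≤ sqDist x y :=
  Finset.sum_nonneg fun _ _ => sq_nonneg _

/-- Upper bound for the upper tail of a chi-square variable. -/
lemma gaussPi_sqDist_gt_le (n : ℕ) {v u : ℝ} (hv : 0 < v) (hu : 0 ≤ u) :
    gaussPi (0 : Fin n → ℝ) v {x | n * (v * Real.exp (2 * u)) < sqDist x 0} ≤
      ENNReal.ofReal (Real.exp (-(n * u ^ 2))) := by
  have hE : 1 + 2 * u + (2 * u) ^ 2 / 2 ≤ Real.exp (2 * u) :=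
    Real.quadratic_le_exp_of_nonneg (by positivity)
  have hpos := Real.exp_pos (2 * u)
  -- Compare with the law of variance `v * exp (2 u)`, for which the threshold is the mean: on the
  -- tail the log-likelihood ratio is at most `-n u²`.
  refine (gaussPi_le_exp_mul 0 0 hv (by positivity : 0 < v * Real.exp (2 * u))
    (measurableSet_lt measurable_const (by fun_prop)) (L := -(n * u ^ 2)) fun x hx => ?_).trans
    (mul_le_of_le_one_right' prob_le_one)
  rw [Set.mem_ofPred_eq] at hx
  have e1 : v / (v * Real.exp (2 * u)) = Real.exp (-(2 * u)) := by
    rw [Real.exp_neg]; field_simp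
  have e2 : -(sqDist x 0 / (2 * v)) + sqDist x 0 / (2 * (v * Real.exp (2 * u))) =
      -(sqDist x 0 / (v * Real.exp (2 * u))) * ((Real.exp (2 * u) - 1) / 2) := by
    field_simp; ring
  have e3 : (n : ℝ) * ((Real.exp (2 * u) - 1) / 2) ≤
      sqDist x 0 / (v * Real.exp (2 * u)) * ((Real.exp (2 * u) - 1) / 2) := by
    refine mul_le_mul_of_nonneg_right ?_ (by nlinarith)
    rw [le_div_iff₀ (by positivity)]
    exact hx.le
  have e4 : (n : ℝ) * (u + u ^ 2) ≤ n * ((Real.exp (2 * u) - 1) / 2) :=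
    mul_le_mul_of_nonneg_left (by linarith) (Nat.cast_nonneg n)
  rw [e1, Real.log_exp]
  linarith

/-- Lower bound for the upper tail of a chi-square variable. -/
lemma le_gaussPi_sqDist_gt {n : ℕ} (hn : n ≠ 0) {v u : ℝ} (hv : 0 < v) (hu : 0 ≤ u) :
    ENNReal.ofReal (1 / 2 * Real.exp (-(n / 2 * (Real.exp (2 * u) - 1 - 2 * u)
      + √n * (Real.exp (2 * u) - 1)))) ≤
    gaussPi (0 : Fin n → ℝ) v
      {x | n * (v * Real.exp (2 * u)) - 2 * √n * (v * Real.exp (2 * u)) < sqDist x 0} := by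
  set E := Real.exp (2 * u) with hE
  have hE0 : 0 < E := Real.exp_pos _
  have hE1 : 1 ≤ E := Real.one_le_exp (by positivity)
  have hsq : √(n : ℝ) ^ 2 = n := Real.sq_sqrt (Nat.cast_nonneg n)
  have hs0 : 0 < √(n : ℝ) := Real.sqrt_pos.2 (by positivity)
  have h00 : sqDist (0 : Fin n → ℝ) 0 = 0 := by simp [sqDist]
  -- Under variance `v * E` the squared norm has mean `n v E` and variance `2 n (v E)²`, so this
  -- window of `√2` standard deviations carries half the mass.
  set A := {x : Fin n → ℝ | |sqDist x 0 - (n * (v * E) + sqDist (0 : Fin n → ℝ) 0)|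
    < 2 * √n * (v * E)} with hA
  have hAm : MeasurableSet A := measurableSet_lt (by fun_prop) measurable_const
  have h1 : ENNReal.ofReal (1 / 2) ≤ gaussPi (0 : Fin n → ℝ) (v * E) A :=
    half_le_gaussPi_abs_sqDist_sub_lt 0 0 (by positivity) (by positivity) (by
      rw [h00, mul_pow (2 * √(n : ℝ)), mul_pow 2, hsq]; nlinarith)
  set L := n / 2 * (E - 1 - 2 * u) + √n * (E - 1) with hL
  have h2 : gaussPi (0 : Fin n → ℝ) (v * E) A ≤
      ENNReal.ofReal (Real.exp L) * gaussPi (0 : Fin n → ℝ) v A := by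
    refine gaussPi_le_exp_mul 0 0 (by positivity) hv hAm fun x hx => ?_
    rw [hA, Set.mem_ofPred_eq, h00, abs_lt] at hx
    have e1 : v * E / v = E := by field_simp
    have e2 : -(sqDist x 0 / (2 * (v * E))) + sqDist x 0 / (2 * v) =
        sqDist x 0 / (v * E) * ((E - 1) / 2) := by
      field_simp; ring
    have e3 : sqDist x 0 / (v * E) * ((E - 1) / 2) ≤ (n + 2 * √n) * ((E - 1) / 2) := by
      refine mul_le_mul_of_nonneg_right ?_ (by linarith)
      rw [div_le_iff₀ (by positivity)]
      linarith [hx.2]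
    rw [e1, hE, Real.log_exp, ← hE]
    linarith
  have h3 : gaussPi (0 : Fin n → ℝ) v A ≤ gaussPi (0 : Fin n → ℝ) v
      {x | n * (v * E) - 2 * √n * (v * E) < sqDist x 0} := by
    refine measure_mono fun x hx => ?_
    rw [hA, Set.mem_ofPred_eq, h00, abs_lt] at hx
    rw [Set.mem_ofPred_eq]
    linarith [hx.1]
  calc ENNReal.ofReal (1 / 2 * Real.exp (-L))
      = ENNReal.ofReal (Real.exp (-L)) * ENNReal.ofReal (1 / 2) := by
        rw [mul_comm, ENNReal.ofReal_mul (Real.exp_pos _).le]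
    _ ≤ ENNReal.ofReal (Real.exp (-L)) *
        (ENNReal.ofReal (Real.exp L) * gaussPi (0 : Fin n → ℝ) v A) := by
        gcongr; exact h1.trans h2
    _ = gaussPi (0 : Fin n → ℝ) v A := by
        rw [← mul_assoc, ← ENNReal.ofReal_mul (Real.exp_pos _).le, ← Real.exp_add]; simp
    _ ≤ _ := h3

/-! ### Probability that a random codeword suits a point -/

/-- A Gaussian codeword of variance `s - D` lies within distortion slightly above `D` of any fixed
point of power at most `s` with probability about `(D / s) ^ (n / 2)`. -/
lemma le_gaussPi_sqDist_le_add {n : ℕ} (hn : n ≠ 0) {D s : ℝ} (hD : 0 < D) (hs : D < s)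
    {x : Fin n → ℝ} (hx : sqDist x 0 ≤ n * s) :
    ENNReal.ofReal (1 / 2 * Real.exp (-(n / 2 * Real.log (s / D) + 2 * √n))) ≤
    gaussPi (0 : Fin n → ℝ) (s - D) {c | sqDist c x ≤ n * D + 4 * √n * D} := by
  have hs0 : 0 < s := hD.trans hs
  have hsD : 0 < s - D := sub_pos.2 hs
  have hsq : √(n : ℝ) ^ 2 = n := Real.sq_sqrt (Nat.cast_nonneg n)
  have hr0 : 0 < √(n : ℝ) := Real.sqrt_pos.2 (by positivity)
  have hx0 := sqDist_nonneg x 0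
  -- `β` and `m` below are the conditional variance and mean of the codeword given `x` in the test
  -- channel `x = c + noise`, with noise of variance `D` and `x` of variance `s`.
  set β := D * (s - D) / s with hβ
  have hβ0 : 0 < β := by positivity
  have hβD : β ≤ D := by rw [hβ, div_le_iff₀ hs0]; nlinarith
  set m : Fin n → ℝ := (1 - D / s) • x with hm
  have hmx : sqDist m x = (D / s) ^ 2 * sqDist x 0 := by
    simp only [sqDist, hm, Finset.mul_sum]
    refine Finset.sum_congr rfl fun i _ => ?_
    simp; ring
  have hmx1 : sqDist m x ≤ n * (D - β) := by
    have : n * (D - β) = (D / s) ^ 2 * (n * s) := by rw [hβ]; field_simp; ring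
    rw [hmx, this]
    gcongr
  have hmx0 := sqDist_nonneg m x
  set A := {c : Fin n → ℝ | |sqDist c x - (n * β + sqDist m x)| < 4 * √n * D} with hA
  have hAm : MeasurableSet A := measurableSet_lt (by fun_prop) measurable_const
  have h1 : ENNReal.ofReal (1 / 2) ≤ gaussPi m β A := by
    refine half_le_gaussPi_abs_sqDist_sub_lt m x hβ0 (by positivity) ?_
    have a1 : β * sqDist m x ≤ D * (n * D) := by
      refine mul_le_mul hβD (hmx1.trans ?_) hmx0 hD.le
      gcongr; linarith
    have a2 : (n : ℝ) * β ^ 2 ≤ n * D ^ 2 := by gcongr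
    rw [mul_pow, mul_pow, hsq]
    nlinarith
  set L := n / 2 * Real.log (s / D) + 2 * √n with hL
  have h2 : gaussPi m β A ≤
      ENNReal.ofReal (Real.exp L) * gaussPi (0 : Fin n → ℝ) (s - D) A := by
    refine gaussPi_le_exp_mul m 0 hβ0 hsD hAm fun c hc => ?_
    rw [hA, Set.mem_ofPred_eq, abs_lt] at hc
    have e1 : β / (s - D) = (s / D)⁻¹ := by rw [hβ]; field_simp
    -- Bayes' rule: the exponent of the joint density of `(c, x)`, factored in both orders.
    have e2 : -(sqDist c m / (2 * β)) + sqDist c 0 / (2 * (s - D)) =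
        -(sqDist c x / (2 * D)) + sqDist x 0 / (2 * s) := by
      simp only [sqDist, Finset.sum_div, ← Finset.sum_neg_distrib, ← Finset.sum_add_distrib]
      refine Finset.sum_congr rfl fun i _ => ?_
      simp only [hm, hβ, Pi.smul_apply, smul_eq_mul, Pi.zero_apply, sub_zero]
      field_simp
      ring
    have e3 : n * β + (D / s) ^ 2 * sqDist x 0 - 4 * √n * D ≤ sqDist c x := by
      rw [← hmx]; linarith [hc.1]
    have e4 : sqDist x 0 / (2 * s) ≤ sqDist c x / (2 * D) + 2 * √n := by
      have a1 : (n * β + (D / s) ^ 2 * sqDist x 0 - 4 * √n * D) / (2 * D) ≤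
          sqDist c x / (2 * D) := by gcongr
      have a2 : (n * β + (D / s) ^ 2 * sqDist x 0 - 4 * √n * D) / (2 * D) + 2 * √n
          - sqDist x 0 / (2 * s) = (n * s - sqDist x 0) * ((s - D) / (2 * s ^ 2)) := by
        rw [hβ]; field_simp; ring
      have a3 : 0 ≤ (n * s - sqDist x 0) * ((s - D) / (2 * s ^ 2)) :=
        mul_nonneg (sub_nonneg.2 hx) (by positivity)
      linarith
    rw [e1, Real.log_inv]
    linarith
  have h3 : gaussPi (0 : Fin n → ℝ) (s - D) A ≤ gaussPi (0 : Fin n → ℝ) (s - D)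
      {c | sqDist c x ≤ n * D + 4 * √n * D} := by
    refine measure_mono fun c hc => ?_
    rw [hA, Set.mem_ofPred_eq, abs_lt] at hc
    rw [Set.mem_ofPred_eq]
    linarith [hc.2]
  calc ENNReal.ofReal (1 / 2 * Real.exp (-L))
      = ENNReal.ofReal (Real.exp (-L)) * ENNReal.ofReal (1 / 2) := by
        rw [mul_comm, ENNReal.ofReal_mul (Real.exp_pos _).le]
    _ ≤ ENNReal.ofReal (Real.exp (-L)) *
        (ENNReal.ofReal (Real.exp L) * gaussPi (0 : Fin n → ℝ) (s - D) A) := by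
        gcongr; exact h1.trans h2
    _ = gaussPi (0 : Fin n → ℝ) (s - D) A := by
        rw [← mul_assoc, ← ENNReal.ofReal_mul (Real.exp_pos _).le, ← Real.exp_add]; simp
    _ ≤ _ := h3

/-- For every `D < s` there is a law of codewords under which a random codeword is within
distortion `D` of any fixed point of power at most `s` with probability about
`(D / s) ^ (n / 2)`. -/
lemma exists_codeword_law {n : ℕ} (hn : n ≠ 0) {D s : ℝ} (hD : 0 < D) (hs : D < s) :
    ∃ Q : Measure (Fin n → ℝ), IsProbabilityMeasure Q ∧ ∀ x, sqDist x 0 ≤ n * s →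
      ENNReal.ofReal (1 / 2 * Real.exp (-(n / 2 * Real.log (s / D) + 4 * √n))) ≤
        Q {c | sqDist c x ≤ n * D} := by
  have hsq : √(n : ℝ) ^ 2 = n := Real.sq_sqrt (Nat.cast_nonneg n)
  have hr0 : 0 < √(n : ℝ) := Real.sqrt_pos.2 (by positivity)
  -- Aiming at distortion `D / q` absorbs the overshoot `4 √n D / q` exactly and costs at most `2
  -- √n` in the exponent.
  set q := 1 + 4 / √(n : ℝ) with hq
  have hq1 : 1 ≤ q := by rw [hq]; linarith [div_pos four_pos hr0]
  have hD' : D / q ≤ D := div_le_self hD.le hq1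
  have hq0 : 0 < q := by linarith
  refine ⟨gaussPi 0 (s - D / q), inferInstance, fun x hx => ?_⟩
  have key := le_gaussPi_sqDist_le_add hn (div_pos hD hq0) (hD'.trans_lt hs) hx
  have e : n * (D / q) + 4 * √n * (D / q) = n * D := by
    have : (n : ℝ) + 4 * √n = n * q := by
      rw [hq]; field_simp
      nlinarith
    rw [← add_mul, this]; field_simp
  rw [e] at key
  refine le_trans (ENNReal.ofReal_le_ofReal ?_) key
  have hlog : Real.log (s / (D / q)) ≤ Real.log (s / D) + 4 / √n := by
    rw [show s / (D / q) = s / D * q by field_simp,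
      Real.log_mul (div_pos (hD.trans hs) hD).ne' hq0.ne']
    linarith [Real.log_le_sub_one_of_pos hq0]
  have h4 : (n : ℝ) / 2 * (4 / √n) = 2 * √n := by
    field_simp; nlinarith
  have : (n : ℝ) / 2 * Real.log (s / (D / q)) ≤ n / 2 * (Real.log (s / D) + 4 / √n) := by gcongr
  have : -(n / 2 * Real.log (s / D) + 4 * √n) ≤
      -(n / 2 * Real.log (s / (D / q)) + 2 * √n) := by linarith
  gcongr

/-! ### Volumes of balls and the likeliest set of given volume -/

/-- Among the sets of volume at most that of `B`, a superlevel set `B` of a density has the largest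
measure. -/
lemma withDensity_le_of_superlevel {α : Type*} [MeasurableSpace α] {μ : Measure α}
    {f : α → ℝ≥0∞} (t : ℝ≥0∞) {A B : Set α} (hA : MeasurableSet A)
    (hB : MeasurableSet B) (hin : ∀ x ∈ B, t ≤ f x) (hout : ∀ x ∉ B, f x ≤ t)
    (hfin : μ A ≠ ∞) (hAB : μ A ≤ μ B) : μ.withDensity f A ≤ μ.withDensity f B := by
  have hdiff : μ (A \ B) ≤ μ (B \ A) := by
    have hi : μ (A ∩ B) ≠ ∞ := measure_ne_top_of_subset Set.inter_subset_left hfin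
    rw [← measure_inter_add_sdiff A hB, ← measure_inter_add_sdiff B hA, Set.inter_comm B A] at hAB
    exact (ENNReal.add_le_add_iff_left hi).1 hAB
  rw [← measure_inter_add_sdiff A hB, ← measure_inter_add_sdiff B hA, Set.inter_comm B A]
  refine add_le_add_right ?_ _
  calc μ.withDensity f (A \ B) = ∫⁻ x in A \ B, f x ∂μ := withDensity_apply _ (hA.diff hB)
    _ ≤ ∫⁻ _ in A \ B, t ∂μ := setLIntegral_mono' (hA.diff hB) fun x hx => hout x hx.2
    _ = t * μ (A \ B) := setLIntegral_const _ _
    _ ≤ t * μ (B \ A) := by gcongr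
    _ = ∫⁻ _ in B \ A, t ∂μ := (setLIntegral_const _ _).symm
    _ ≤ ∫⁻ x in B \ A, f x ∂μ := setLIntegral_mono' (hB.diff hA) fun x hx => hin x hx.1
    _ = μ.withDensity f (B \ A) := (withDensity_apply _ (hB.diff hA)).symm

lemma measurableSet_sqDist_le {n : ℕ} (y : Fin n → ℝ) (r : ℝ) :
    MeasurableSet {x | sqDist x y ≤ r} :=
  measurableSet_le (by fun_prop) measurable_const

lemma volume_sqDist_le_lt_top {n : ℕ} (r : ℝ) :
    volume {x : Fin n → ℝ | sqDist x 0 ≤ r} < ∞ := by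
  refine (measure_mono fun x hx => ?_).trans_lt
    (measure_closedBall_lt_top (x := (0 : Fin n → ℝ)) (r := √r))
  rw [mem_closedBall_zero_iff, pi_norm_le_iff_of_nonneg (Real.sqrt_nonneg _)]
  intro i
  refine Real.abs_le_sqrt ((?_ : x i ^ 2 ≤ sqDist x 0).trans hx)
  have := Finset.single_le_sum (f := fun i => (x i - (0 : Fin n → ℝ) i) ^ 2)
    (fun _ _ => sq_nonneg _) (Finset.mem_univ i)
  simpa [sqDist] using this

lemma volume_sqDist_le_translate {n : ℕ} (y : Fin n → ℝ) (r : ℝ) :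
    volume {x | sqDist x y ≤ r} = volume {x : Fin n → ℝ | sqDist x 0 ≤ r} := by
  have : {x | sqDist x y ≤ r} = (fun x => x + -y) ⁻¹' {x : Fin n → ℝ | sqDist x 0 ≤ r} := by
    ext x; simp [sqDist, sub_eq_add_neg]
  rw [this, measure_preimage_add_right]

/-- `r` is a squared radius, so the dilation by `exp a` multiplies it by `exp (2 a)` and the volume
by `exp (n a)`. -/
lemma volume_sqDist_le_scale {n : ℕ} (r a : ℝ) :
    volume {x : Fin n → ℝ | sqDist x 0 ≤ r * Real.exp (2 * a)} =
      ENNReal.ofReal (Real.exp (n * a)) * volume {x : Fin n → ℝ | sqDist x 0 ≤ r} := by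
  have : {x : Fin n → ℝ | sqDist x 0 ≤ r * Real.exp (2 * a)} =
      (Real.exp (-a) • ·) ⁻¹' {x : Fin n → ℝ | sqDist x 0 ≤ r} := by
    ext x
    have h1 : sqDist (Real.exp (-a) • x) 0 = sqDist x 0 / Real.exp (2 * a) := by
      simp only [sqDist, Finset.sum_div]
      refine Finset.sum_congr rfl fun i _ => ?_
      rw [div_eq_mul_inv, ← Real.exp_neg, show -(2 * a) = -a + -a by ring, Real.exp_add]
      simp; ring
    simp [h1, div_le_iff₀ (Real.exp_pos _)]
  rw [this, Measure.addHaar_preimage_smul _ (Real.exp_pos _).ne']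
  congr 2
  rw [Module.finrank_fintype_fun_eq_card, Fintype.card_fin, ← Real.exp_nat_mul, ← Real.exp_neg,
    abs_of_pos (Real.exp_pos _)]
  ring_nf

/-- The points left uncovered by at most `exp (n a)` balls are at least as likely under a centred
Gaussian law as the complement of the centred ball whose radius is `exp a` times as large. -/
lemma gaussPi_sqDist_gt_le_uncovered {n : ℕ} {v : ℝ} (hv : 0 < v) {ι : Type*}
    [Fintype ι] (y : ι → Fin n → ℝ) {r a : ℝ} (hcard : (Fintype.card ι : ℝ) ≤ Real.exp (n * a)) :
    gaussPi (0 : Fin n → ℝ) v {x | r * Real.exp (2 * a) < sqDist x 0} ≤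
      gaussPi (0 : Fin n → ℝ) v {x | ∀ j, r < sqDist x (y j)} := by
  set R := r * Real.exp (2 * a) with hR
  have hB := measurableSet_sqDist_le (0 : Fin n → ℝ) R
  have hA : MeasurableSet (⋃ j, {x | sqDist x (y j) ≤ r}) :=
    MeasurableSet.iUnion fun j => measurableSet_sqDist_le (y j) r
  have hvol : volume (⋃ j, {x | sqDist x (y j) ≤ r}) ≤
      volume {x : Fin n → ℝ | sqDist x 0 ≤ R} := by
    rw [hR, volume_sqDist_le_scale]
    refine (measure_iUnion_fintype_le _ _).trans ?_
    simp_rw [volume_sqDist_le_translate]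
    rw [Finset.sum_const, nsmul_eq_mul, Finset.card_univ]
    gcongr
    rw [← ENNReal.ofReal_natCast]
    exact ENNReal.ofReal_le_ofReal hcard
  have hle : gaussPi (0 : Fin n → ℝ) v (⋃ j, {x | sqDist x (y j) ≤ r}) ≤
      gaussPi (0 : Fin n → ℝ) v {x | sqDist x 0 ≤ R} := by
    rw [gaussPi_eq_withDensity 0 hv]
    -- The density decreases with the norm; the threshold is its value at squared norm `R`.
    refine withDensity_le_of_superlevel (ENNReal.ofReal
      (Real.exp (-(n / 2) * Real.log (2 * Real.pi * v) - R / (2 * v)))) hA hB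
      (fun x hx => ?_) (fun x hx => ?_) (hvol.trans_lt (volume_sqDist_le_lt_top R)).ne hvol
    · have : sqDist x 0 ≤ R := hx
      gcongr
    · have : R ≤ sqDist x 0 := (not_le.1 hx).le
      gcongr
  have c1 : {x : Fin n → ℝ | R < sqDist x 0} = {x | sqDist x 0 ≤ R}ᶜ := by ext; simp
  have c2 : {x : Fin n → ℝ | ∀ j, r < sqDist x (y j)} = (⋃ j, {x | sqDist x (y j) ≤ r})ᶜ := by
    ext; simp
  rw [c1, c2, prob_compl_eq_one_sub hB, prob_compl_eq_one_sub hA]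
  exact tsub_le_tsub_left hle _

/-! ### Random coding and construction of codes -/

/-- Random coding: if a random codeword suits every point of `G` with probability at least `p`,
then some codebook of at least `n / p` words leaves a part of `G` of probability at most
`exp (-n)` unserved. -/
lemma exists_codebook {Ω E : Type*} [MeasurableSpace Ω] [MeasurableSpace E] (P : Measure Ω)
    [IsProbabilityMeasure P] (Q : Measure E) [IsProbabilityMeasure Q] {G : Set Ω}
    (hG : MeasurableSet G) {S : Set (Ω × E)} (hS : MeasurableSet S) {p : ℝ} (hp : 0 ≤ p)
    (hcov : ∀ x ∈ G, ENNReal.ofReal p ≤ Q {c | (x, c) ∈ S}) {n M : ℕ} (hM : n ≤ M * p) :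
    ∃ C : Fin M → E, P (G ∩ {x | ∀ j, (x, C j) ∉ S}) ≤ ENNReal.ofReal (Real.exp (-n)) := by
  set T : Set (Ω × (Fin M → E)) := {z | z.1 ∈ G ∧ ∀ j, (z.1, z.2 j) ∉ S} with hT
  have hTm : MeasurableSet T := by
    have h1 : MeasurableSet {z : Ω × (Fin M → E) | z.1 ∈ G} := measurable_fst hG
    have h2 : ∀ j, MeasurableSet {z : Ω × (Fin M → E) | (z.1, z.2 j) ∉ S} := fun j =>
      (by fun_prop : Measurable fun z : Ω × (Fin M → E) => (z.1, z.2 j)) hS.compl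
    have : T = {z | z.1 ∈ G} ∩ ⋂ j, {z | (z.1, z.2 j) ∉ S} := by ext; simp [hT]
    rw [this]
    exact h1.inter (MeasurableSet.iInter h2)
  -- Some codebook does no worse than the average over codebooks of independent words drawn from
  -- `Q`.
  obtain ⟨C, hC⟩ := exists_le_lintegral (μ := Measure.pi fun _ : Fin M => Q)
    (f := fun C => P ((fun x => (x, C)) ⁻¹' T)) (measurable_measure_prodMk_right hTm).aemeasurable
  refine ⟨C, hC.trans ?_⟩
  rw [← Measure.prod_apply_symm hTm, Measure.prod_apply hTm]
  refine (lintegral_mono (g := fun _ => ENNReal.ofReal (Real.exp (-n))) fun x => ?_).trans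
    (by simp)
  by_cases hx : x ∈ G
  · have hSx : MeasurableSet {c | (x, c) ∈ S} := measurable_prodMk_left hS
    have e : Prod.mk x ⁻¹' T = Set.univ.pi fun _ : Fin M => {c | (x, c) ∈ S}ᶜ := by
      ext C; simp [hT, hx]
    have hp1 : p ≤ 1 := by
      have := (hcov x hx).trans prob_le_one
      simpa using this
    rw [e, Measure.pi_pi, Finset.prod_const, Finset.card_univ, Fintype.card_fin,
      prob_compl_eq_one_sub hSx]
    calc (1 - Q {c | (x, c) ∈ S}) ^ M ≤ (1 - ENNReal.ofReal p) ^ M := by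
          gcongr; exact hcov x hx
      _ = ENNReal.ofReal ((1 - p) ^ M) := by
          rw [← ENNReal.ofReal_one, ← ENNReal.ofReal_sub _ hp,
            ENNReal.ofReal_pow (by linarith)]
      _ ≤ ENNReal.ofReal (Real.exp (-n)) := by
          refine ENNReal.ofReal_le_ofReal ?_
          calc (1 - p) ^ M ≤ Real.exp (-p) ^ M := by
                refine pow_le_pow_left₀ (by linarith) ?_ M
                linarith [Real.add_one_le_exp (-p)]
            _ = Real.exp (-(M * p)) := by rw [← Real.exp_nat_mul]; ring_nf
            _ ≤ Real.exp (-n) := by gcongr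
  · have : Prod.mk x ⁻¹' T = ∅ := by ext C; simp [hT, hx]
    simp [this]

/-- A finite family of measurable sets has a measurable choice of index on its union. -/
lemma exists_measurable_selection {Ω : Type*} [MeasurableSpace Ω] {M : ℕ} (hM : M ≠ 0)
    {U : Fin M → Set Ω} (hU : ∀ j, MeasurableSet (U j)) :
    ∃ f : Ω → Fin M, Measurable f ∧ ∀ x, (∃ j, x ∈ U j) → x ∈ U (f x) := by
  classical
  -- The clause `M ≤ k` makes the search for the first index stop off the union as well.
  let p : Ω → ℕ → Prop := fun x k => M ≤ k ∨ ∃ h : k < M, x ∈ U ⟨k, h⟩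
  have hp : ∀ x, ∃ N, p x N := fun x => ⟨M, Or.inl le_rfl⟩
  have hm : ∀ k, MeasurableSet {x | p x k} := fun k => by
    by_cases hk : k < M
    · have : {x | p x k} = U ⟨k, hk⟩ := by ext x; simp [p, hk]
      rw [this]; exact hU _
    · have : {x | p x k} = Set.univ := by ext x; simp [p, not_lt.1 hk]
      rw [this]; exact MeasurableSet.univ
  let g : ℕ → Fin M := fun k => if h : k < M then ⟨k, h⟩ else ⟨0, Nat.pos_of_ne_zero hM⟩
  refine ⟨fun x => g (Nat.find (hp x)), (measurable_of_countable g).comp (measurable_find hp hm),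
    fun x ⟨j, hj⟩ => ?_⟩
  have hlt : Nat.find (hp x) < M :=
    (Nat.find_min' (hp x) (Or.inr ⟨j.2, hj⟩)).trans_lt j.2
  obtain h | ⟨h, hx⟩ := Nat.find_spec (hp x)
  · exact absurd hlt (not_lt.2 h)
  · simpa [g, hlt] using hx

/-- The number of codewords needed by random coding with success probability
`exp (-(h + 4 √n)) / 2`. -/
lemma exists_codebook_size {n : ℕ} (hn : n ≠ 0) {h : ℝ} (hh : 0 ≤ h) :
    ∃ M : ℕ, M ≠ 0 ∧ (n : ℝ) ≤ M * (1 / 2 * Real.exp (-(h + 4 * √n))) ∧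
      Real.log M ≤ h + 8 * √n := by
  have hn1 : (1 : ℝ) ≤ n := by exact_mod_cast Nat.one_le_iff_ne_zero.2 hn
  have hr0 : 0 < √(n : ℝ) := Real.sqrt_pos.2 (by positivity)
  set B := 2 * n * Real.exp (h + 4 * √n) with hB
  have hE : 1 ≤ Real.exp (h + 4 * √n) := Real.one_le_exp (by positivity)
  have hB1 : 1 ≤ B := by rw [hB]; nlinarith
  have hM := Nat.le_ceil B
  have hM' := Nat.ceil_lt_add_one (by linarith : 0 ≤ B)
  have hM0 : (0 : ℝ) < ⌈B⌉₊ := by linarith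
  refine ⟨⌈B⌉₊, fun h0 => by simp [h0] at hM0, ?_, ?_⟩
  · calc (n : ℝ) = B * (1 / 2 * Real.exp (-(h + 4 * √n))) := by
          rw [hB, Real.exp_neg]; field_simp
      _ ≤ _ := by gcongr
  · calc Real.log ⌈B⌉₊ ≤ Real.log (2 * B) := Real.log_le_log hM0 (by linarith)
      -- The factor `4 n` is written as a square so that `log t ≤ t - 1` at `t = 2 √n` bounds its
      -- logarithm by `4 √n`.
      _ = Real.log ((2 * √n) ^ 2) + (h + 4 * √n) := by
          rw [mul_pow, Real.sq_sqrt (by positivity), hB,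
            show 2 * (2 * (n : ℝ) * Real.exp (h + 4 * √n)) =
              2 ^ 2 * n * Real.exp (h + 4 * √n) by ring,
            Real.log_mul (by positivity) (Real.exp_pos _).ne', Real.log_exp]
      _ ≤ h + 8 * √n := by
          rw [Real.log_pow]
          have := Real.log_le_sub_one_of_pos (by positivity : 0 < 2 * √(n : ℝ))
          push_cast
          linarith

/-- A quantizer of about `(s / D) ^ (n / 2)` cells that reproduces within distortion `D` nearly all
values of power at most `s` of a random vector `r`. -/
lemma exists_quantizer {Ω : Type*} [MeasurableSpace Ω] (P : Measure Ω) [IsProbabilityMeasure P]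
    {n : ℕ} (hn : n ≠ 0) {r : Ω → Fin n → ℝ} (hr : Measurable r) {D s : ℝ} (hD : 0 < D)
    (hs : D < s) :
    ∃ (M : ℕ) (f : Ω → Fin M) (C : Fin M → Fin n → ℝ), Measurable f ∧ M ≠ 0 ∧
      Real.log M ≤ n / 2 * Real.log (s / D) + 8 * √n ∧
      P {x | sqDist (r x) 0 ≤ n * s ∧ n * D < sqDist (C (f x)) (r x)} ≤
        ENNReal.ofReal (Real.exp (-n)) := by
  have hlog : 0 ≤ Real.log (s / D) := Real.log_nonneg ((one_le_div hD).2 hs.le)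
  obtain ⟨Q, hQ, hcov⟩ := exists_codeword_law hn hD hs
  obtain ⟨M, hM0, hM, hMlog⟩ := exists_codebook_size hn
    (h := n / 2 * Real.log (s / D)) (by positivity)
  obtain ⟨C, hC⟩ := exists_codebook P Q (G := {x | sqDist (r x) 0 ≤ n * s})
    (measurableSet_le (by fun_prop) measurable_const)
    (S := {z | sqDist z.2 (r z.1) ≤ n * D}) (measurableSet_le (by fun_prop) measurable_const)
    (by positivity) (fun x hx => hcov (r x) hx) hM
  obtain ⟨f, hf, hsel⟩ := exists_measurable_selection hM0
    (U := fun j => {x | sqDist (C j) (r x) ≤ n * D})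
    fun j => measurableSet_le (by fun_prop) measurable_const
  refine ⟨M, f, C, hf, hM0, hMlog, (measure_mono ?_).trans hC⟩
  refine fun x hx => ⟨hx.1, fun j hj => ?_⟩
  exact absurd (hsel x ⟨j, hj⟩) (not_le.2 hx.2)

lemma lt_blockDistortion_quadDist {n : ℕ} (hn : n ≠ 0) (D : ℝ) (x y : Fin n → ℝ) :
    D < blockDistortion quadDist x y ↔ n * D < sqDist x y := by
  have hn0 : (0 : ℝ) < n := by positivity
  rw [blockDistortion, one_div_mul_eq_div, lt_div_iff₀ hn0, mul_comm]
  rfl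

lemma sqDist_comm {n : ℕ} (x y : Fin n → ℝ) : sqDist x y = sqDist y x :=
  Finset.sum_congr rfl fun i _ => by ring

/-- Successively refinable Gaussian codes: the excess rate of both layers is `u`, and the
excess-distortion probability is essentially `exp (-n u²)`. -/
lemma exists_code {n : ℕ} (hn : n ≠ 0) {v D₁ D₂ u : ℝ} (hD₂ : 0 < D₂) (hD : D₂ < D₁)
    (hv : D₁ < v) (hu : 0 ≤ u) :
    ∃ (M₁ M₂ : ℕ) (c : Code ℝ ℝ ℝ n M₁ M₂),
      Real.log M₁ ≤ n * (1 / 2 * Real.log (v / D₁) + u) + 16 * √n ∧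
      Real.log (M₁ * M₂) ≤ n * (1 / 2 * Real.log (v / D₂) + u) + 16 * √n ∧
      excessProb (gaussianReal 0 v.toNNReal) quadDist quadDist D₁ D₂ c ≤
        ENNReal.ofReal (Real.exp (-(n * u ^ 2)) + 2 * Real.exp (-n)) := by
  have hD₁ : 0 < D₁ := hD₂.trans hD
  have hv0 : 0 < v := hD₁.trans hv
  have hE : 1 ≤ Real.exp (2 * u) := Real.one_le_exp (by positivity)
  have hr0 : 0 ≤ √(n : ℝ) := Real.sqrt_nonneg _
  set P := gaussPi (0 : Fin n → ℝ) v with hP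
  obtain ⟨M₁, f₁, C₁, hf₁, hM₁, hlog₁, herr₁⟩ := exists_quantizer P hn
    (r := fun x => x) measurable_id hD₁ (s := v * Real.exp (2 * u)) (by nlinarith)
  have hC₁ : Measurable fun x => C₁ (f₁ x) := (measurable_of_countable C₁).comp hf₁
  -- The residual has power at most `D₁` whenever the first layer succeeds, so this codebook size
  -- does not depend on `u`.
  obtain ⟨M₂, f₂, C₂, hf₂, hM₂, hlog₂, herr₂⟩ := exists_quantizer P hn
    (r := fun x => x - C₁ (f₁ x)) (by fun_prop) hD₂ hD
  have e₁ : Real.log (v * Real.exp (2 * u) / D₁) = Real.log (v / D₁) + 2 * u := by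
    rw [mul_div_right_comm, Real.log_mul (by positivity) (Real.exp_pos _).ne', Real.log_exp]
  have e₂ : Real.log (v / D₁) + Real.log (D₁ / D₂) = Real.log (v / D₂) := by
    rw [← Real.log_mul (by positivity) (by positivity)]
    congr 1; field_simp
  rw [e₁] at hlog₁
  refine ⟨M₁, M₂, ⟨f₁, f₂, hf₁, hf₂, C₁, fun z => C₁ z.1 + C₂ z.2⟩, by linarith, ?_, ?_⟩
  · rw [Real.log_mul (by exact_mod_cast hM₁) (by exact_mod_cast hM₂), ← e₂]
    linarith
  · rw [ENNReal.ofReal_add (by positivity) (by positivity), two_mul,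
      ENNReal.ofReal_add (by positivity) (by positivity)]
    have htail := gaussPi_sqDist_gt_le n hv0 hu
    refine (measure_mono ?_).trans ((measure_union_le _ _).trans (add_le_add htail
      ((measure_union_le _ _).trans (add_le_add herr₁ herr₂))))
    intro x hx
    simp only [Set.mem_ofPred_eq, lt_blockDistortion_quadDist hn] at hx
    by_cases h1 : n * (v * Real.exp (2 * u)) < sqDist x 0
    · exact Or.inl h1
    by_cases h2 : n * D₁ < sqDist x (C₁ (f₁ x))
    · exact Or.inr (Or.inl ⟨not_lt.1 h1, by rwa [sqDist_comm]⟩)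
    refine Or.inr (Or.inr ⟨?_, ?_⟩)
    · have : sqDist (x - C₁ (f₁ x)) 0 = sqDist x (C₁ (f₁ x)) := by simp [sqDist]
      rw [this]; exact not_lt.1 h2
    · have : sqDist (C₂ (f₂ x)) (x - C₁ (f₁ x)) = sqDist x (C₁ (f₁ x) + C₂ (f₂ x)) := by
        rw [sqDist_comm]
        exact Finset.sum_congr rfl fun i _ => by simp [sub_sub]
      rw [this]
      exact hx.resolve_left h2

/-! ### Converse bounds for codes -/

/-- Converse bound for a single decoder with codebook `y`. -/
lemma gaussPi_sqDist_gt_le_of_log_card_le {n : ℕ} {v D a : ℝ} (hv : 0 < v)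
    (hD : 0 < D) {ι : Type*} [Fintype ι] [Nonempty ι] (y : ι → Fin n → ℝ)
    (h : Real.log (Fintype.card ι) ≤ n * (1 / 2 * Real.log (v / D) + a)) :
    gaussPi (0 : Fin n → ℝ) v {x | n * (v * Real.exp (2 * a)) < sqDist x 0} ≤
      gaussPi (0 : Fin n → ℝ) v {x | ∀ j, n * D < sqDist x (y j)} := by
  have hcard : (0 : ℝ) < Fintype.card ι := by exact_mod_cast Fintype.card_pos
  have key := gaussPi_sqDist_gt_le_uncovered hv y (r := n * D) ((Real.log_le_iff_le_exp hcard).1 h)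
  have e : n * D * Real.exp (2 * (1 / 2 * Real.log (v / D) + a)) =
      n * (v * Real.exp (2 * a)) := by
    rw [show 2 * (1 / 2 * Real.log (v / D) + a) = Real.log (v / D) + 2 * a by ring, Real.exp_add,
      Real.exp_log (div_pos hv hD)]
    field_simp
  rwa [e] at key

lemma le_excessProb_of_log_first_le {n M₁ M₂ : ℕ} (hn : n ≠ 0) {v D₁ D₂ a : ℝ} (hv : 0 < v)
    (hD₁ : 0 < D₁) (c : Code ℝ ℝ ℝ n M₁ M₂)
    (h : Real.log M₁ ≤ n * (1 / 2 * Real.log (v / D₁) + a)) :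
    gaussPi (0 : Fin n → ℝ) v {x | n * (v * Real.exp (2 * a)) < sqDist x 0} ≤
      excessProb (gaussianReal 0 v.toNNReal) quadDist quadDist D₁ D₂ c := by
  have : Nonempty (Fin M₁) := ⟨c.f₁ 0⟩
  refine (gaussPi_sqDist_gt_le_of_log_card_le hv hD₁ c.φ₁ (by simpa using h)).trans
    (measure_mono fun x hx => Or.inl ?_)
  rw [lt_blockDistortion_quadDist hn]
  exact hx _

/-- The second decoder acts as a single decoder with a codebook indexed by pairs of messages. -/
lemma le_excessProb_of_log_sum_le {n M₁ M₂ : ℕ} (hn : n ≠ 0) {v D₁ D₂ a : ℝ} (hv : 0 < v)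
    (hD₂ : 0 < D₂) (c : Code ℝ ℝ ℝ n M₁ M₂)
    (h : Real.log ((M₁ : ℝ) * M₂) ≤ n * (1 / 2 * Real.log (v / D₂) + a)) :
    gaussPi (0 : Fin n → ℝ) v {x | n * (v * Real.exp (2 * a)) < sqDist x 0} ≤
      excessProb (gaussianReal 0 v.toNNReal) quadDist quadDist D₁ D₂ c := by
  have : Nonempty (Fin M₁ × Fin M₂) := ⟨(c.f₁ 0, c.f₂ 0)⟩
  refine (gaussPi_sqDist_gt_le_of_log_card_le hv hD₂ c.φ₂ (by simpa using h)).trans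
    (measure_mono fun x hx => Or.inr ?_)
  rw [lt_blockDistortion_quadDist hn]
  exact hx _

/-! ### Normalised limits at moderate deviations speed -/

lemma limsup_coe_le_of_tendsto {f g : ℕ → ℝ} {a : ℝ} (h : ∀ᶠ n in atTop, f n ≤ g n)
    (hg : Tendsto g atTop (𝓝 a)) : limsup (fun n => (f n : EReal)) atTop ≤ a := by
  have hg' : Tendsto (fun n => (g n : EReal)) atTop (𝓝 (a : EReal)) :=
    (continuous_coe_real_ereal.tendsto a).comp hg
  rw [← hg'.limsup_eq]
  exact limsup_le_limsup (h.mono fun n hn => EReal.coe_le_coe_iff.2 hn)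

section Speed

variable {ρ : ℕ → ℝ}

lemma eventually_speed_pos (hρ : Tendsto (fun n : ℕ => √n * ρ n) atTop atTop) :
    ∀ᶠ n : ℕ in atTop, n ≠ 0 ∧ 0 < ρ n := by
  filter_upwards [eventually_ne_atTop 0, hρ.eventually_gt_atTop 0] with n hn h
  exact ⟨hn, pos_of_mul_pos_right h (Real.sqrt_nonneg _)⟩

lemma tendsto_const_div_sqrt_mul_speed (hρ : Tendsto (fun n : ℕ => √n * ρ n) atTop atTop)
    (K : ℝ) : Tendsto (fun n : ℕ => K / (√n * ρ n)) atTop (𝓝 0) :=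
  hρ.const_div_atTop K

lemma tendsto_const_div_mul_speed_sq (hρ : Tendsto (fun n : ℕ => √n * ρ n) atTop atTop)
    (K : ℝ) : Tendsto (fun n : ℕ => K / (n * ρ n ^ 2)) atTop (𝓝 0) := by
  refine (((tendsto_pow_atTop two_ne_zero).comp hρ).const_div_atTop K).congr fun n => ?_
  simp [mul_pow]

/-- The normalized excess rate of codes whose logarithmic size is within `K √n` of
`n (R + θ ρ)`. -/
lemma limsup_excess_rate_le (hρ₀ : Tendsto ρ atTop (𝓝 0))
    (hρ : Tendsto (fun n : ℕ => √n * ρ n) atTop atTop) {ℓ : ℕ → ℝ} {R R' θ θ' K : ℝ}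
    (hℓ : ∀ n : ℕ, n ≠ 0 → 0 < ρ n → ℓ n ≤ n * (R + θ * ρ n) + K * √n)
    (hR : R < R' ∨ R = R' ∧ θ ≤ θ') :
    limsup (fun n : ℕ => (((1 / (n * ρ n)) * (ℓ n - n * R') : ℝ) : EReal)) atTop ≤
      (θ' : EReal) := by
  have hK := tendsto_const_div_sqrt_mul_speed hρ K
  have hb : ∀ᶠ n : ℕ in atTop, (1 / (n * ρ n)) * (ℓ n - n * R') ≤
      θ + K / (√n * ρ n) + (R - R') / ρ n := by
    filter_upwards [eventually_speed_pos hρ] with n ⟨hn, hp⟩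
    have hn0 : (0 : ℝ) < n := by positivity
    have hs0 : 0 < √(n : ℝ) := Real.sqrt_pos.2 hn0
    have hsq : √(n : ℝ) * √n = n := Real.mul_self_sqrt hn0.le
    have e : K / (√n * ρ n) = K * √n / (n * ρ n) := by
      rw [div_eq_div_iff (by positivity) (by positivity)]
      linear_combination (-(K * ρ n)) * hsq
    rw [one_div_mul_eq_div, div_le_iff₀ (by positivity), e]
    have : (θ + K * √n / (n * ρ n) + (R - R') / ρ n) * (n * ρ n) =
      n * (R + θ * ρ n) + K * √n - n * R' := by field_simp; ring
    rw [this]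
    linarith [hℓ n hn hp]
  obtain hlt | ⟨rfl, hθ⟩ := hR
  -- With strict slack, `(R - R') / ρ n → -∞` outweighs any backoff.
  · refine limsup_coe_le_of_tendsto (g := fun _ => θ') ?_ tendsto_const_nhds
    have hpos : ∀ᶠ n in atTop, 0 < ρ n := (eventually_speed_pos hρ).mono fun n h => h.2
    have hinv : Tendsto (fun n => (R' - R) / ρ n) atTop atTop :=
      Tendsto.const_mul_atTop (sub_pos.2 hlt) (tendsto_inv_nhdsGT_zero.comp
        (tendsto_nhdsWithin_iff.2 ⟨hρ₀, hpos⟩))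
    filter_upwards [hb, hK.eventually (gt_mem_nhds one_pos),
      hinv.eventually_ge_atTop (θ + 1 - θ')] with n h1 h2 h3
    rw [← neg_sub R' R, neg_div] at h1
    linarith
  · refine (limsup_coe_le_of_tendsto (g := fun n : ℕ => θ + K / (√n * ρ n))
      (hb.mono fun n h => by simpa using h) (a := θ) ?_).trans (EReal.coe_le_coe_iff.2 hθ)
    simpa using tendsto_const_nhds.add hK

/-- Lower bound for the normalized exponent of a sequence of probabilities. -/
lemma le_liminf_exponent (hρ₀ : Tendsto ρ atTop (𝓝 0))
    (hρ : Tendsto (fun n : ℕ => √n * ρ n) atTop atTop) {ε : ℕ → ℝ≥0∞} {θ : ℝ}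
    (hε : ∀ n : ℕ, n ≠ 0 → 0 < ρ n →
      ε n ≤ ENNReal.ofReal (Real.exp (-(n * (θ * ρ n) ^ 2)) + 2 * Real.exp (-n))) :
    ((θ ^ 2 : ℝ) : EReal) ≤
      liminf (fun n : ℕ => -ENNReal.log (ε n) / ((n * ρ n ^ 2 : ℝ) : EReal)) atTop := by
  have hlim : Tendsto (fun n : ℕ => θ ^ 2 - Real.log 3 / (n * ρ n ^ 2)) atTop (𝓝 (θ ^ 2)) := by
    simpa using tendsto_const_nhds.sub (tendsto_const_div_mul_speed_sq hρ (Real.log 3))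
  have hlim' := (continuous_coe_real_ereal.tendsto (θ ^ 2)).comp hlim
  rw [← hlim'.liminf_eq]
  -- Once `(θ ρ n)² < 1`, the coding error `exp (-n)` is below the tail term, leaving a factor `3`
  -- that vanishes after normalisation.
  have hsmall : ∀ᶠ n in atTop, (θ * ρ n) ^ 2 < 1 := by
    have : Tendsto (fun n => (θ * ρ n) ^ 2) atTop (𝓝 0) := by
      simpa using (hρ₀.const_mul θ).pow 2
    exact this.eventually (gt_mem_nhds one_pos)
  refine liminf_le_liminf ?_
  filter_upwards [eventually_speed_pos hρ, hsmall] with n ⟨hn, hp⟩ hs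
  have hn0 : (0 : ℝ) < n := by positivity
  have hden : 0 < n * ρ n ^ 2 := by positivity
  have h3 : ε n ≤ ENNReal.ofReal (3 * Real.exp (-(n * (θ * ρ n) ^ 2))) := by
    refine (hε n hn hp).trans (ENNReal.ofReal_le_ofReal ?_)
    have : Real.exp (-n) ≤ Real.exp (-(n * (θ * ρ n) ^ 2)) :=
      Real.exp_le_exp.2 (by nlinarith)
    linarith
  have hlog := ENNReal.log_monotone h3
  rw [ENNReal.log_ofReal_of_pos (by positivity), Real.log_mul (by norm_num)
    (Real.exp_pos _).ne', Real.log_exp] at hlog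
  have hneg := EReal.neg_le_neg_iff.2 hlog
  rw [← EReal.coe_neg] at hneg
  refine le_trans (le_of_eq ?_) (EReal.div_le_div_right_of_nonneg
    (EReal.coe_nonneg.2 hden.le) hneg)
  rw [← EReal.coe_div]
  simp only [Function.comp]
  congr 1
  field_simp
  ring

/-- Upper bound for the normalized exponent of a sequence of probabilities. -/
lemma liminf_exponent_le (hρ : Tendsto (fun n : ℕ => √n * ρ n) atTop atTop) {ε : ℕ → ℝ≥0∞}
    {B : ℕ → ℝ} {b : ℝ} (hB : Tendsto B atTop (𝓝 b))
    (hε : ∀ᶠ n : ℕ in atTop,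
      ENNReal.ofReal (1 / 2 * Real.exp (-(n * ρ n ^ 2 * B n))) ≤ ε n) :
    liminf (fun n : ℕ => -ENNReal.log (ε n) / ((n * ρ n ^ 2 : ℝ) : EReal)) atTop ≤
      (b : EReal) := by
  have hlim : Tendsto (fun n : ℕ => B n + Real.log 2 / (n * ρ n ^ 2)) atTop (𝓝 b) := by
    simpa using hB.add (tendsto_const_div_mul_speed_sq hρ (Real.log 2))
  have hlim' := (continuous_coe_real_ereal.tendsto b).comp hlim
  rw [← hlim'.liminf_eq]
  refine liminf_le_liminf ?_
  filter_upwards [eventually_speed_pos hρ, hε] with n ⟨hn, hp⟩ h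
  have hden : 0 < n * ρ n ^ 2 := by positivity
  have hlog := ENNReal.log_monotone h
  rw [ENNReal.log_ofReal_of_pos (by positivity), Real.log_mul (by norm_num)
    (Real.exp_pos _).ne', Real.log_exp] at hlog
  have hneg := EReal.neg_le_neg_iff.2 hlog
  rw [← EReal.coe_neg] at hneg
  refine (EReal.div_le_div_right_of_nonneg (EReal.coe_nonneg.2 hden.le) hneg).trans
    (le_of_eq ?_)
  rw [← EReal.coe_div]
  simp only [Function.comp]
  congr 1
  rw [one_div, Real.log_inv]
  field_simp
  ring

/-- Taylor's bound of order three; the second inequality gives the relative entropy its leading term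
`n u²`. -/
lemma exp_two_mul_bounds {u : ℝ} (h0 : 0 ≤ u) (h1 : 2 * u ≤ 1) :
    Real.exp (2 * u) - 1 ≤ 2 * u + 4 * u ^ 2 ∧
      Real.exp (2 * u) - 1 - 2 * u ≤ 2 * u ^ 2 + 2 * u ^ 3 := by
  have h3 := Real.exp_bound' (by positivity : 0 ≤ 2 * u) h1 (n := 3) (by norm_num)
  simp [Finset.sum_range_succ, Nat.factorial] at h3
  have h4 : 0 ≤ u ^ 2 := by positivity
  have h5 : 0 ≤ u ^ 3 := by positivity
  have h6 : u ^ 3 ≤ u ^ 2 * (1 / 2) := by nlinarith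
  constructor <;> nlinarith

/-- Moderate deviations lower bound for the upper tail of a chi-square variable. -/
lemma liminf_exponent_le_of_tail_le (hρ₀ : Tendsto ρ atTop (𝓝 0))
    (hρ : Tendsto (fun n : ℕ => √n * ρ n) atTop atTop) {ε : ℕ → ℝ≥0∞} {v θ θ' : ℝ} (hv : 0 < v)
    (hθ : 0 < θ) (hθ' : θ < θ')
    (hε : ∀ᶠ n : ℕ in atTop, gaussPi (0 : Fin n → ℝ) v
      {x | n * (v * Real.exp (2 * (θ * ρ n))) < sqDist x 0} ≤ ε n) :
    liminf (fun n : ℕ => -ENNReal.log (ε n) / ((n * ρ n ^ 2 : ℝ) : EReal)) atTop ≤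
      ((θ' ^ 2 : ℝ) : EReal) := by
  have hθ0 : 0 < θ' := hθ.trans hθ'
  -- `B` is the bound on the exponent in `le_gaussPi_sqDist_gt` at `u = θ' ρ n`, after Taylor
  -- expansion and division by `n ρ n ^ 2`.
  refine liminf_exponent_le hρ (B := fun n : ℕ => θ' ^ 2 + θ' ^ 3 * ρ n +
    (2 * θ' + 4 * θ' ^ 2 * ρ n) * (1 / (√n * ρ n))) ?_ ?_
  · have h1 := (hρ₀.const_mul (θ' ^ 3)).const_add (θ' ^ 2)
    have h2 := ((hρ₀.const_mul (4 * θ' ^ 2)).const_add (2 * θ')).mul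
      (tendsto_const_div_sqrt_mul_speed hρ 1)
    simpa using h1.add h2
  have hsmall : ∀ᶠ n in atTop, 2 * (θ' * ρ n) < 1 := by
    have : Tendsto (fun n => 2 * (θ' * ρ n)) atTop (𝓝 0) := by
      simpa using (hρ₀.const_mul θ').const_mul 2
    exact this.eventually (gt_mem_nhds one_pos)
  filter_upwards [eventually_speed_pos hρ, hsmall, hε,
    hρ.eventually_ge_atTop (2 / (θ' - θ))] with n ⟨hn, hp⟩ hs hεn hlarge
  have hn0 : (0 : ℝ) < n := by positivity
  have hs0 : 0 < √(n : ℝ) := Real.sqrt_pos.2 hn0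
  have hsq : √(n : ℝ) ^ 2 = n := Real.sq_sqrt hn0.le
  set u := θ' * ρ n with hu
  have hu0 : 0 < u := by positivity
  obtain ⟨b1, b2⟩ := exp_two_mul_bounds hu0.le hs.le
  refine (ENNReal.ofReal_le_ofReal ?_).trans ((le_gaussPi_sqDist_gt hn hv hu0.le).trans
    ((measure_mono fun x hx => ?_).trans hεn))
  · have c1 : (n : ℝ) / 2 * (Real.exp (2 * u) - 1 - 2 * u) ≤ n / 2 * (2 * u ^ 2 + 2 * u ^ 3) := by
      gcongr
    have c2 : √n * (Real.exp (2 * u) - 1) ≤ √n * (2 * u + 4 * u ^ 2) := by gcongr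
    have c3 : n * ρ n ^ 2 * (θ' ^ 2 + θ' ^ 3 * ρ n +
        (2 * θ' + 4 * θ' ^ 2 * ρ n) * (1 / (√n * ρ n))) =
        n / 2 * (2 * u ^ 2 + 2 * u ^ 3) + √n * (2 * u + 4 * u ^ 2) := by
      have : n * ρ n ^ 2 * (1 / (√n * ρ n)) = √n * ρ n := by
        rw [← hsq]
        simp only [Real.sqrt_sq hs0.le]
        field_simp
      rw [mul_add, mul_left_comm _ _ (1 / (√n * ρ n)), this, hu]
      ring
    rw [c3]
    gcongr
  · rw [Set.mem_ofPred_eq] at hx ⊢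
    refine lt_of_le_of_lt ?_ hx
    -- The gap `θ < θ'` lifts the threshold by `exp y`; since `√n y ≥ 4` eventually, this outweighs
    -- the relative loss `2 / √n` of the window.
    set y := 2 * ((θ' - θ) * ρ n) with hy
    have hy0 : 0 < y := by
      have := sub_pos.2 hθ'
      positivity
    have hy1 : y ≤ 1 := by
      have : 0 < θ * ρ n := by positivity
      linarith
    have hyl : 4 ≤ √n * y := by
      rw [div_le_iff₀ (sub_pos.2 hθ')] at hlarge
      rw [hy]; linarith
    have hE : Real.exp (2 * u) = Real.exp (2 * (θ * ρ n)) * Real.exp y := by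
      rw [← Real.exp_add, hy, hu]; ring_nf
    have hey : 1 + y ≤ Real.exp y := by linarith [Real.add_one_le_exp y]
    have hfac : (n : ℝ) ≤ (n - 2 * √n) * Real.exp y := by
      have h2 : 2 ≤ √(n : ℝ) := by nlinarith
      have : 0 ≤ (n : ℝ) - 2 * √n := by nlinarith
      calc (n : ℝ) ≤ (n - 2 * √n) * (1 + y) := by nlinarith
        _ ≤ _ := by gcongr
    rw [hE]
    have := mul_le_mul_of_nonneg_right hfac
      (by positivity : 0 ≤ v * Real.exp (2 * (θ * ρ n)))
    linarith

end Speed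

/-! ### Achievable constants and their upper bounds -/

section Gaussian

variable {v D₁ D₂ : ℝ} {ρ : ℕ → ℝ}

/-- One backoff `θ` serves both layers, so only the tight layers restrict it. -/
lemma isAchievableMD_sq (hD₂ : 0 < D₂) (hD : D₂ < D₁) (hv : D₁ < v)
    (hρ₀ : Tendsto ρ atTop (𝓝 0)) (hρ : Tendsto (fun n : ℕ => √n * ρ n) atTop atTop)
    {θ θ₁ θ₂ R₁ R₂ : ℝ} (hθ : 0 < θ)
    (h₁ : 1 / 2 * Real.log (v / D₁) < R₁ ∨ 1 / 2 * Real.log (v / D₁) = R₁ ∧ θ ≤ θ₁)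
    (h₂ : 1 / 2 * Real.log (v / D₂) < R₂ ∨ 1 / 2 * Real.log (v / D₂) = R₂ ∧ θ ≤ θ₂) :
    IsAchievableMD (gaussianReal 0 v.toNNReal) quadDist quadDist D₁ D₂ ρ θ₁ θ₂ R₁ R₂
      (θ ^ 2) := by
  have hcode : ∀ n : ℕ, ∃ (M₁ M₂ : ℕ) (c : Code ℝ ℝ ℝ n M₁ M₂), n ≠ 0 → 0 < ρ n →
      Real.log M₁ ≤ n * (1 / 2 * Real.log (v / D₁) + θ * ρ n) + 16 * √n ∧
      Real.log (M₁ * M₂) ≤ n * (1 / 2 * Real.log (v / D₂) + θ * ρ n) + 16 * √n ∧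
      excessProb (gaussianReal 0 v.toNNReal) quadDist quadDist D₁ D₂ c ≤
        ENNReal.ofReal (Real.exp (-(n * (θ * ρ n) ^ 2)) + 2 * Real.exp (-n)) := fun n => by
    by_cases h : n ≠ 0 ∧ 0 < ρ n
    · obtain ⟨M₁, M₂, c, hc⟩ := exists_code h.1 hD₂ hD hv (mul_pos hθ h.2).le
      exact ⟨M₁, M₂, c, fun _ _ => hc⟩
    -- A trivial code for the finitely many `n` with `n = 0` or `ρ n ≤ 0`, invisible in the limits.
    · exact ⟨1, 1, ⟨fun _ => 0, fun _ => 0, measurable_const, measurable_const, fun _ => 0,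
        fun _ => 0⟩, fun hn hp => absurd ⟨hn, hp⟩ h⟩
  choose M₁ M₂ c hc using hcode
  exact ⟨M₁, M₂, c, limsup_excess_rate_le hρ₀ hρ (fun n hn hp => (hc n hn hp).1) h₁,
    limsup_excess_rate_le hρ₀ hρ (fun n hn hp => (hc n hn hp).2.1) h₂,
    le_liminf_exponent hρ₀ hρ fun n hn hp => (hc n hn hp).2.2⟩

lemma le_sq_of_rate_constraint (hv : 0 < v) (hρ₀ : Tendsto ρ atTop (𝓝 0))
    (hρ : Tendsto (fun n : ℕ => √n * ρ n) atTop atTop) {ε : ℕ → ℝ≥0∞} {ℓ : ℕ → ℝ}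
    {θ ν R : ℝ} (hθ : 0 < θ)
    (hconv : ∀ n : ℕ, n ≠ 0 → ∀ a, ℓ n ≤ n * (R + a) →
      gaussPi (0 : Fin n → ℝ) v {x | n * (v * Real.exp (2 * a)) < sqDist x 0} ≤ ε n)
    (hrate : limsup (fun n : ℕ => (((1 / (n * ρ n)) * (ℓ n - n * R) : ℝ) : EReal)) atTop ≤
      (θ : EReal))
    (hν : (ν : EReal) ≤
      liminf (fun n : ℕ => -ENNReal.log (ε n) / ((n * ρ n ^ 2 : ℝ) : EReal)) atTop) :
    ν ≤ θ ^ 2 := by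
  -- One `δ` turns the upper limit into an eventual bound on the rate, the other is the gap needed
  -- by the tail estimate.
  have key : ∀ δ > 0, ν ≤ (θ + 2 * δ) ^ 2 := fun δ hδ => by
    refine EReal.coe_le_coe_iff.1 (hν.trans (liminf_exponent_le_of_tail_le hρ₀ hρ hv
      (by linarith : 0 < θ + δ) (by linarith) ?_))
    have hlt : limsup (fun n : ℕ => (((1 / (n * ρ n)) * (ℓ n - n * R) : ℝ) : EReal)) atTop <
        ((θ + δ : ℝ) : EReal) :=
      hrate.trans_lt (EReal.coe_lt_coe_iff.2 (by linarith))
    filter_upwards [eventually_lt_of_limsup_lt hlt, eventually_speed_pos hρ] with n h ⟨hn, hp⟩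
    refine hconv n hn _ ?_
    rw [EReal.coe_lt_coe_iff, one_div_mul_eq_div, div_lt_iff₀ (by positivity)] at h
    linarith
  have hlim : Tendsto (fun δ : ℝ => (θ + 2 * δ) ^ 2) (𝓝[>] 0) (𝓝 (θ ^ 2)) := by
    have : Continuous fun δ : ℝ => (θ + 2 * δ) ^ 2 := by fun_prop
    simpa using (this.tendsto 0).mono_left nhdsWithin_le_nhds
  exact ge_of_tendsto hlim (eventually_nhdsWithin_of_forall key)

lemma IsAchievableMD.le_sq_first (hv : 0 < v) (hD₁ : 0 < D₁) (hρ₀ : Tendsto ρ atTop (𝓝 0))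
    (hρ : Tendsto (fun n : ℕ => √n * ρ n) atTop atTop) {θ₁ θ₂ R₂ ν : ℝ} (hθ : 0 < θ₁)
    (h : IsAchievableMD (gaussianReal 0 v.toNNReal) quadDist quadDist D₁ D₂ ρ θ₁ θ₂
      (1 / 2 * Real.log (v / D₁)) R₂ ν) : ν ≤ θ₁ ^ 2 := by
  obtain ⟨M₁, M₂, c, h1, -, h3⟩ := h
  exact le_sq_of_rate_constraint hv hρ₀ hρ hθ
    (fun n hn a ha => le_excessProb_of_log_first_le hn hv hD₁ (c n) ha) h1 h3

lemma IsAchievableMD.le_sq_sum (hv : 0 < v) (hD₂ : 0 < D₂) (hρ₀ : Tendsto ρ atTop (𝓝 0))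
    (hρ : Tendsto (fun n : ℕ => √n * ρ n) atTop atTop) {θ₁ θ₂ R₁ ν : ℝ} (hθ : 0 < θ₂)
    (h : IsAchievableMD (gaussianReal 0 v.toNNReal) quadDist quadDist D₁ D₂ ρ θ₁ θ₂
      R₁ (1 / 2 * Real.log (v / D₂)) ν) : ν ≤ θ₂ ^ 2 := by
  obtain ⟨M₁, M₂, c, -, h2, h3⟩ := h
  exact le_sq_of_rate_constraint hv hρ₀ hρ hθ
    (fun n hn a ha => le_excessProb_of_log_sum_le hn hv hD₂ (c n) ha) h2 h3

end Gaussian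

lemma mdConstant_eq_of_isGreatest {X Y Z : Type*} [MeasurableSpace X] {P : Measure X}
    {d₁ : X → Y → ℝ} {d₂ : X → Z → ℝ} {D₁ D₂ : ℝ} {ρ : ℕ → ℝ} {θ₁ θ₂ R₁ R₂ μ : ℝ}
    (hμ : IsAchievableMD P d₁ d₂ D₁ D₂ ρ θ₁ θ₂ R₁ R₂ μ)
    (hle : ∀ ν, IsAchievableMD P d₁ d₂ D₁ D₂ ρ θ₁ θ₂ R₁ R₂ ν → ν ≤ μ) :
    mdConstant P d₁ d₂ D₁ D₂ ρ θ₁ θ₂ R₁ R₂ = μ :=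
  le_antisymm (iSup₂_le fun ν hν => EReal.coe_le_coe_iff.2 (hle ν hν))
    (le_iSup₂ (f := fun (ν : ℝ) (_ : IsAchievableMD P d₁ d₂ D₁ D₂ ρ θ₁ θ₂ R₁ R₂ ν) =>
      (ν : EReal)) μ hμ)

end SuccRef

theorem theorem6 (σ D₁ D₂ : ℝ) (hD₂ : 0 < D₂) (hD : D₂ < D₁) (hσ : D₁ < σ ^ 2)
    (ρ : ℕ → ℝ) (hρ₀ : Tendsto ρ atTop (𝓝 0))
    (hρ : Tendsto (fun n : ℕ => Real.sqrt n * ρ n) atTop atTop)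
    (θ₁ θ₂ : ℝ) (hθ₁ : 0 < θ₁) (hθ₂ : 0 < θ₂) (R₁ R₂ : ℝ) :
    (1 / 2 * Real.log (σ ^ 2 / D₁) < R₁ → R₁ < 1 / 2 * Real.log (σ ^ 2 / D₂) →
      R₂ = 1 / 2 * Real.log (σ ^ 2 / D₂) →
      SuccRef.gaussianMDConstant σ D₁ D₂ ρ θ₁ θ₂ R₁ R₂ = ((θ₂ ^ 2 : ℝ) : EReal)) ∧
    (R₁ = 1 / 2 * Real.log (σ ^ 2 / D₁) → 1 / 2 * Real.log (σ ^ 2 / D₂) < R₂ →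
      SuccRef.gaussianMDConstant σ D₁ D₂ ρ θ₁ θ₂ R₁ R₂ = ((θ₁ ^ 2 : ℝ) : EReal)) ∧
    (R₁ = 1 / 2 * Real.log (σ ^ 2 / D₁) → R₂ = 1 / 2 * Real.log (σ ^ 2 / D₂) →
      SuccRef.gaussianMDConstant σ D₁ D₂ ρ θ₁ θ₂ R₁ R₂ =
        ((min (θ₁ ^ 2) (θ₂ ^ 2) : ℝ) : EReal)) := by
  have hD₁ : 0 < D₁ := hD₂.trans hD
  have hv : 0 < σ ^ 2 := hD₁.trans hσ
  have hvar : (⟨σ ^ 2, sq_nonneg σ⟩ : NNReal) = (σ ^ 2).toNNReal :=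
    (Real.toNNReal_of_nonneg (sq_nonneg σ)).symm
  have hmin : min (θ₁ ^ 2) (θ₂ ^ 2) = (min θ₁ θ₂) ^ 2 := by
    obtain h | h := le_total θ₁ θ₂
    · rw [min_eq_left h, min_eq_left (by gcongr)]
    · rw [min_eq_right h, min_eq_right (by gcongr)]
  simp only [SuccRef.gaussianMDConstant, hvar]
  refine ⟨fun h₁ _ h₂ => ?_, fun h₁ h₂ => ?_, fun h₁ h₂ => ?_⟩
  · subst h₂
    exact SuccRef.mdConstant_eq_of_isGreatest
      (SuccRef.isAchievableMD_sq hD₂ hD hσ hρ₀ hρ hθ₂ (.inl h₁) (.inr ⟨rfl, le_rfl⟩))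
      fun ν hν => hν.le_sq_sum hv hD₂ hρ₀ hρ hθ₂
  · subst h₁
    exact SuccRef.mdConstant_eq_of_isGreatest
      (SuccRef.isAchievableMD_sq hD₂ hD hσ hρ₀ hρ hθ₁ (.inr ⟨rfl, le_rfl⟩) (.inl h₂))
      fun ν hν => hν.le_sq_first hv hD₁ hρ₀ hρ hθ₁
  · subst h₁ h₂
    refine SuccRef.mdConstant_eq_of_isGreatest ?_ fun ν hν =>
      le_min (hν.le_sq_first hv hD₁ hρ₀ hρ hθ₁) (hν.le_sq_sum hv hD₂ hρ₀ hρ hθ₂)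
    -- Both layers are tight, so the common backoff is the smaller of the two.
    rw [hmin]
    exact SuccRef.isAchievableMD_sq hD₂ hD hσ hρ₀ hρ (lt_min hθ₁ hθ₂)
      (.inr ⟨rfl, min_le_left _ _⟩) (.inr ⟨rfl, min_le_right _ _⟩)
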